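/- Let $M\subseteq B(H)$ and $N\subseteq B(K)$ be von Neumann algebras on complex Hilbert spaces $H$ and $K$. A nonzero projection $p$ of a von Neumann algebra $M$ is minimal if $pMp=\mathbb{C}p$, and $M$ is atomic if it equals the weak$^*$ (ultraweak) closure of the linear span of its minimal projections. Write $S(M^+)$ for the set of positive elements of norm one of $M$, with the metric given by the operator norm, and $\mathcal{P}roj(M)^*\subseteq S(M^+)$ for the set of nonzero (self-adjoint) projections of $M$; similarly for $N$. Suppose that $M$ and $N$ are atomic and that $\Delta: S(M^+)\to S(N^+)$ is a surjective isometry, that is, a surjective map with $\|\Delta(a)-\Delta(b)\|=\|a-b\|$ for all $a,b\in S(M^+)$. Then $\Delta(\mathcal{P}roj(M)^*)=\mathcal{P}roj(N)^*$, and the restriction $\Delta|_{\mathcal{P}roj(M)^*}:\mathcal{P}roj(M)^*\to\mathcal{P}roj(N)^*$ is a surjective isometry. -/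

import Mathlib

namespace VonNeumannAlgebra

section

variable {H : Type*} [NormedAddCommGroup H] [InnerProductSpace ℂ H]

/-- The series defining a normal functional on `B(H)` converges absolutely. -/
theorem summable_inner_of_sq_summable {ξ η : ℕ → H}
    (hξ : Summable fun n => ‖ξ n‖ ^ 2) (hη : Summable fun n => ‖η n‖ ^ 2) (x : H →L[ℂ] H) :
    Summable fun n => inner ℂ (η n) (x (ξ n)) := by
  refine Summable.of_norm_bounded (g := fun n => ‖x‖ * (‖η n‖ ^ 2 + ‖ξ n‖ ^ 2))
    ((hη.add hξ).mul_left _) fun n => ?_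
  calc ‖inner ℂ (η n) (x (ξ n))‖ ≤ ‖η n‖ * ‖x (ξ n)‖ := norm_inner_le_norm _ _
    _ ≤ ‖η n‖ * (‖x‖ * ‖ξ n‖) := by gcongr; exact x.le_opNorm _
    _ = ‖x‖ * (‖η n‖ * ‖ξ n‖) := by ring
    _ ≤ ‖x‖ * (‖η n‖ ^ 2 + ‖ξ n‖ ^ 2) := by
      gcongr
      nlinarith [sq_nonneg (‖η n‖ - ‖ξ n‖), sq_nonneg (‖η n‖ + ‖ξ n‖)]

variable (H) in
/-- The weak* (ultraweak, or σ-weak) topology of `B(H)`, as the dual of the trace class operators: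
the coarsest topology making continuous all functionals `x ↦ ∑ n, ⟪η n, x (ξ n)⟫`, where
`ξ` and `η` are square summable sequences in `H`. A von Neumann algebra on `H` is closed in it,
and its own weak* topology is the induced one. -/
noncomputable abbrev ultraweakTopology : TopologicalSpace (H →L[ℂ] H) :=
  ⨅ (ξ : ℕ → H) (η : ℕ → H) (_ : Summable fun n => ‖ξ n‖ ^ 2) (_ : Summable fun n => ‖η n‖ ^ 2),
    TopologicalSpace.induced (fun x : H →L[ℂ] H => ∑' n, inner ℂ (η n) (x (ξ n))) inferInstance

variable [CompleteSpace H]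

/-- The set of nonzero (self-adjoint) projections of `M`. -/
def nonzeroProjections (M : VonNeumannAlgebra H) : Set (H →L[ℂ] H) :=
  {p | p ∈ M ∧ IsStarProjection p ∧ p ≠ 0}

/-- The set of minimal projections of `M`: the nonzero projections `p ∈ M` with `p M p = ℂ p`. -/
def minimalProjections (M : VonNeumannAlgebra H) : Set (H →L[ℂ] H) :=
  {p | p ∈ M.nonzeroProjections ∧
    {y | ∃ x ∈ M, y = p * x * p} = {y | ∃ c : ℂ, y = c • p}}

/-- `M` is atomic if it is the weak* closure of the linear span of its minimal projections. -/
def IsAtomicAlgebra (M : VonNeumannAlgebra H) : Prop :=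
  @closure _ (ultraweakTopology H) (Submodule.span ℂ M.minimalProjections : Set (H →L[ℂ] H))
    = (M : Set (H →L[ℂ] H))

/-- The set `S(M⁺)` of positive elements of norm one of `M`. -/
def posUnitSphere (M : VonNeumannAlgebra H) : Set (H →L[ℂ] H) :=
  {a | a ∈ M ∧ 0 ≤ a ∧ ‖a‖ = 1}

theorem nonzeroProjections_subset (M : VonNeumannAlgebra H) :
    M.nonzeroProjections ⊆ M.posUnitSphere := by
  rintro p ⟨hM, hp, h0⟩
  refine ⟨hM, hp.nonneg, ?_⟩
  have h : ‖p‖ = ‖p‖ * ‖p‖ := by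
    conv_lhs => rw [← hp.isIdempotentElem.eq]
    conv_lhs => enter [1, 1]; rw [← hp.isSelfAdjoint.star_eq]
    exact CStarRing.norm_star_mul_self
  exact (mul_left_cancel₀ (norm_ne_zero_iff.2 h0) (by rw [mul_one]; exact h)).symm

/-- The inclusion of the nonzero projections of `M` in `S(M⁺)`. -/
def projInclusion (M : VonNeumannAlgebra H) : M.nonzeroProjections → M.posUnitSphere :=
  Set.inclusion M.nonzeroProjections_subset

end

end VonNeumannAlgebra

/-! Projections are singled out inside `S(M⁺)` by the metric alone: `a` is a projection iff `a` is
the only `b` such that every `x` at distance one from `a` is at distance one from `b`. A surjective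
isometry preserves this condition. By `norm_sub_eq_one_iff`, distance one means that some unit
vectors are almost fixed by one operator and almost killed by the other. Squaring keeps both
properties, so `b = a * a` passes the test, and uniqueness forces `a * a = a`. Conversely, let `b`
pass the test for a projection `p`. Suitable midpoints `x` show `b * e = 0` for minimal `e`
orthogonal to `p` and `(1 - b) * e = 0` for minimal `e` below `p`; minimality turns approximate
statements into exact ones (`mul_eq_zero_of_approx`). Atomicity extends these to `b * (1 - p) = 0`
and `(1 - b) * p = 0`, so `b = p`. -/

namespace VonNeumannAlgebra

/-! ### Distance one between positive contractions. -/

section Operators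

variable {H : Type*} [NormedAddCommGroup H] [InnerProductSpace ℂ H]

/-- There are unit vectors almost fixed by `a` and almost annihilated by `b`. -/
def ApproxSeparated (a b : H →L[ℂ] H) : Prop :=
  ∀ ε > (0 : ℝ), ∃ ξ : H, ‖ξ‖ = 1 ∧ ‖a ξ - ξ‖ < ε ∧ ‖b ξ‖ < ε

theorem ApproxSeparated.one_le_norm_sub {a b : H →L[ℂ] H} (h : ApproxSeparated a b) :
    1 ≤ ‖a - b‖ := by
  refine le_of_forall_pos_le_add fun ε hε => ?_
  obtain ⟨ξ, h1, h2, h3⟩ := h (ε / 2) (half_pos hε)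
  have h4 : ‖(a - b) ξ‖ ≤ ‖a - b‖ := by simpa [h1] using (a - b).le_opNorm ξ
  have h5 : ξ = (a - b) ξ - (a ξ - ξ) + b ξ := by simp
  have h6 : ‖ξ‖ ≤ ‖(a - b) ξ‖ + ‖a ξ - ξ‖ + ‖b ξ‖ := by
    conv_lhs => rw [h5]
    exact (norm_add_le _ _).trans (add_le_add_left (norm_sub_le _ _) _)
  linarith

theorem ApproxSeparated.sq_right {a b : H →L[ℂ] H} (h : ApproxSeparated a b) (hb1 : ‖b‖ ≤ 1) :
    ApproxSeparated a (b * b) := fun ε hε => by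
  obtain ⟨ξ, h1, h2, h3⟩ := h ε hε
  refine ⟨ξ, h1, h2, lt_of_le_of_lt ?_ h3⟩
  simpa using b.le_of_opNorm_le hb1 (b ξ)

theorem ApproxSeparated.sq_left {a b : H →L[ℂ] H} (h : ApproxSeparated a b) (ha1 : ‖a‖ ≤ 1) :
    ApproxSeparated (a * a) b := fun ε hε => by
  obtain ⟨ξ, h1, h2, h3⟩ := h (ε / 2) (half_pos hε)
  refine ⟨ξ, h1, ?_, h3.trans (half_lt_self hε)⟩
  have h4 : (a * a) ξ - ξ = a (a ξ - ξ) + (a ξ - ξ) := by simp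
  have h5 : ‖a (a ξ - ξ)‖ ≤ ‖a ξ - ξ‖ := by simpa using a.le_of_opNorm_le ha1 (a ξ - ξ)
  rw [h4]
  linarith [norm_add_le (a (a ξ - ξ)) (a ξ - ξ)]

theorem approxSeparated_of_fixed {a b : H →L[ℂ] H} {ξ : H} (hξ : ‖ξ‖ = 1) (ha : a ξ = ξ)
    (hb : b ξ = 0) : ApproxSeparated a b := fun ε hε => ⟨ξ, hξ, by simpa [ha], by simpa [hb]⟩

theorem norm_apply_lt_of_eq_mul {a b c : H →L[ℂ] H} {ξ : H} {ε C : ℝ} (h : a = c * b)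
    (hc : ‖c‖ ≤ C) (hC : 0 < C) (hb : ‖b ξ‖ < ε / C) : ‖a ξ‖ < ε := by
  rw [h]
  calc ‖c (b ξ)‖ ≤ C * ‖b ξ‖ := c.le_of_opNorm_le hc _
    _ < C * (ε / C) := by gcongr
    _ = ε := by field_simp

variable [CompleteSpace H]

/-- This is `a² ≤ a` for a positive contraction, read off from `a = s* s` with `‖s‖ ≤ 1`. -/
theorem norm_apply_sq_le_re_inner {a : H →L[ℂ] H} (ha : 0 ≤ a) (ha1 : ‖a‖ ≤ 1) (ξ : H) :
    ‖a ξ‖ ^ 2 ≤ (inner ℂ (a ξ) ξ).re := by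
  obtain ⟨s, rfl⟩ := CStarAlgebra.nonneg_iff_eq_star_mul_self.1 ha
  have hs : ‖s‖ ≤ 1 := by
    rw [CStarRing.norm_star_mul_self] at ha1
    nlinarith [norm_nonneg s]
  have h1 : (inner ℂ ((star s * s) ξ) ξ).re = ‖s ξ‖ ^ 2 := by
    rw [mul_apply_eq_comp, ContinuousLinearMap.star_eq_adjoint,
      ContinuousLinearMap.adjoint_inner_left]
    exact inner_self_eq_norm_sq (𝕜 := ℂ) _
  rw [h1]
  gcongr
  calc ‖(star s * s) ξ‖ ≤ ‖star s‖ * ‖s ξ‖ := (star s).le_opNorm (s ξ)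
    _ ≤ 1 * ‖s ξ‖ := by gcongr; rwa [norm_star]
    _ = ‖s ξ‖ := one_mul _

theorem norm_sub_le_one {a b : H →L[ℂ] H} (ha : 0 ≤ a) (hb : 0 ≤ b) (ha1 : ‖a‖ ≤ 1)
    (hb1 : ‖b‖ ≤ 1) : ‖a - b‖ ≤ 1 := by
  have hs : IsSelfAdjoint (a - b) := (IsSelfAdjoint.of_nonneg ha).sub (.of_nonneg hb)
  rw [ContinuousLinearMap.norm_eq_iSup_rayleighQuotient _ hs.isSymmetric]
  refine ciSup_le fun ξ => ?_
  have key : ∀ {c : H →L[ℂ] H}, 0 ≤ c → ‖c‖ ≤ 1 →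
      0 ≤ (inner ℂ (c ξ) ξ).re ∧ (inner ℂ (c ξ) ξ).re ≤ ‖ξ‖ ^ 2 := fun {c} hc hc1 => by
    refine ⟨((ContinuousLinearMap.nonneg_iff_isPositive c).1 hc).re_inner_nonneg_left ξ, ?_⟩
    calc (inner ℂ (c ξ) ξ).re ≤ ‖c ξ‖ * ‖ξ‖ := re_inner_le_norm (𝕜 := ℂ) _ _
      _ ≤ (1 * ‖ξ‖) * ‖ξ‖ := by gcongr; exact c.le_of_opNorm_le hc1 ξ
      _ = ‖ξ‖ ^ 2 := by ring
  have h1 := key ha ha1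
  have h2 := key hb hb1
  rw [ContinuousLinearMap.rayleighQuotient, abs_div, abs_sq]
  refine div_le_one_of_le₀ ?_ (sq_nonneg _)
  rw [ContinuousLinearMap.reApplyInnerSelf_apply, sub_apply, inner_sub_left,
    abs_le]
  simp only [RCLike.re_to_complex, Complex.sub_re]
  constructor <;> linarith

theorem norm_sq_lt_of_lt_re_inner {a b : H →L[ℂ] H} (hb : 0 ≤ b) (ha1 : ‖a‖ ≤ 1)
    (hb1 : ‖b‖ ≤ 1) {ξ : H} (hξ : ‖ξ‖ = 1) {δ : ℝ}
    (h : 1 - δ < (inner ℂ ((a - b) ξ) ξ).re) :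
    ‖a ξ - ξ‖ ^ 2 < 2 * δ ∧ ‖b ξ‖ ^ 2 < δ := by
  have h1 := norm_apply_sq_le_re_inner hb hb1 ξ
  have h2 : ‖a ξ‖ ≤ 1 := by simpa [hξ] using a.le_of_opNorm_le ha1 ξ
  have h3 : (inner ℂ (a ξ) ξ).re ≤ ‖a ξ‖ * ‖ξ‖ := re_inner_le_norm (𝕜 := ℂ) _ _
  have h4 := norm_sub_sq (𝕜 := ℂ) (a ξ) ξ
  have h5 : 0 ≤ (inner ℂ (b ξ) ξ).re :=
    ((ContinuousLinearMap.nonneg_iff_isPositive b).1 hb).re_inner_nonneg_left ξ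
  rw [sub_apply, inner_sub_left, Complex.sub_re] at h
  rw [hξ] at h3 h4
  simp only [RCLike.re_to_complex] at h4
  constructor
  · nlinarith [norm_nonneg (a ξ)]
  · nlinarith

theorem norm_sub_eq_one_iff {a b : H →L[ℂ] H} (ha : 0 ≤ a) (hb : 0 ≤ b) (ha1 : ‖a‖ ≤ 1)
    (hb1 : ‖b‖ ≤ 1) : ‖a - b‖ = 1 ↔ ApproxSeparated a b ∨ ApproxSeparated b a := by
  constructor
  · intro h
    have hex : ∀ ε > (0 : ℝ), ∃ ξ : H, ‖ξ‖ = 1 ∧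
        (‖a ξ - ξ‖ < ε ∧ ‖b ξ‖ < ε ∨ ‖b ξ - ξ‖ < ε ∧ ‖a ξ‖ < ε) := by
      intro ε hε
      have hs : IsSelfAdjoint (a - b) := (IsSelfAdjoint.of_nonneg ha).sub (.of_nonneg hb)
      have hsup := ContinuousLinearMap.norm_eq_iSup_rayleighQuotient _ hs.isSymmetric
      -- The bound `1 / 2` excludes the zero vector, whose Rayleigh quotient is `0`; the other gives
      -- `2 * δ ≤ ε ^ 2`.
      set δ := min (1 / 2) (ε ^ 2 / 2) with hδ
      have hδ0 : 0 < δ := lt_min (by norm_num) (by positivity)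
      have hδ1 : δ ≤ 1 / 2 := min_le_left _ _
      have hδ2 : δ ≤ ε ^ 2 / 2 := min_le_right _ _
      obtain ⟨x, hx⟩ := exists_lt_of_lt_ciSup (show 1 - δ < _ from by
        rw [← hsup, h]; linarith)
      have hx0 : x ≠ 0 := by
        rintro rfl
        simp only [ContinuousLinearMap.rayleighQuotient_apply_zero, abs_zero] at hx
        linarith
      have hn : ‖x‖ ≠ 0 := norm_ne_zero_iff.2 hx0
      set ξ : H := ((‖x‖⁻¹ : ℝ) : ℂ) • x with hξdef
      have hξ : ‖ξ‖ = 1 := by simp [hξdef, norm_smul, hn]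
      have hr : (a - b).rayleighQuotient ξ = (a - b).rayleighQuotient x :=
        (a - b).rayleigh_smul x (by simpa using hn)
      rw [← hr, ContinuousLinearMap.rayleighQuotient, hξ, one_pow, div_one,
        ContinuousLinearMap.reApplyInnerSelf_apply] at hx
      have hlt : ∀ {y : H}, ‖y‖ ^ 2 < 2 * δ → ‖y‖ < ε := fun {y} hy =>
        lt_of_pow_lt_pow_left₀ 2 hε.le (by linarith)
      refine ⟨ξ, hξ, ?_⟩
      rcases lt_abs.1 hx with hx | hx
      · obtain ⟨h1, h2⟩ := norm_sq_lt_of_lt_re_inner hb ha1 hb1 hξ hx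
        exact .inl ⟨hlt h1, hlt (by linarith)⟩
      · have hx' : 1 - δ < (inner ℂ ((b - a) ξ) ξ).re := by
          rw [← neg_sub a b, neg_apply, inner_neg_left]
          exact hx
        obtain ⟨h1, h2⟩ := norm_sq_lt_of_lt_re_inner ha hb1 ha1 hξ hx'
        exact .inr ⟨hlt h1, hlt (by linarith)⟩
    -- The alternative in `hex` may depend on `ε`; if each side failed at some tolerance, both would
    -- fail at the smaller one.
    by_contra! hcon
    simp only [ApproxSeparated, not_forall] at hcon
    obtain ⟨⟨ε, hε, h1⟩, ⟨ε', hε', h2⟩⟩ := hcon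
    obtain ⟨ξ, hξ, h3 | h3⟩ := hex (min ε ε') (lt_min hε hε')
    · exact h1 ⟨ξ, hξ, h3.1.trans_le (min_le_left _ _), h3.2.trans_le (min_le_left _ _)⟩
    · exact h2 ⟨ξ, hξ, h3.1.trans_le (min_le_right _ _), h3.2.trans_le (min_le_right _ _)⟩
  · intro h
    refine le_antisymm (norm_sub_le_one ha hb ha1 hb1) ?_
    rcases h with h | h
    · exact h.one_le_norm_sub
    · rw [norm_sub_rev]
      exact h.one_le_norm_sub

theorem mul_eq_zero_of_compression_eq_zero {a e : H →L[ℂ] H} (ha : 0 ≤ a) (ha1 : ‖a‖ ≤ 1)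
    (he : IsStarProjection e) (h : e * a * e = 0) : a * e = 0 := by
  ext ξ
  have h1 := norm_apply_sq_le_re_inner ha ha1 (e ξ)
  have h2 : inner ℂ (a (e ξ)) (e ξ) = 0 := by
    have h3 : inner ℂ (e (a (e ξ))) ξ = inner ℂ (a (e ξ)) (e ξ) :=
      he.isSelfAdjoint.isSymmetric _ _
    rw [← h3]
    have h4 : e (a (e ξ)) = 0 := congr($h ξ)
    rw [h4, inner_zero_left]
  rw [h2, Complex.zero_re] at h1
  simpa using le_antisymm h1 (sq_nonneg _)

end Operators

/-! ### Minimal projections and atomicity. -/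

section Atomic

variable {H : Type*} [NormedAddCommGroup H] [InnerProductSpace ℂ H] [CompleteSpace H]
  {M : VonNeumannAlgebra H}

theorem smul_mem_of_mem {a : H →L[ℂ] H} (ha : a ∈ M) (c : ℂ) : c • a ∈ M :=
  M.toStarSubalgebra.smul_mem ha c

theorem exists_compression_eq_smul {e : H →L[ℂ] H} (he : e ∈ M.minimalProjections)
    {a : H →L[ℂ] H} (ha : a ∈ M) : ∃ c : ℂ, e * a * e = c • e :=
  he.2.subset ⟨a, ha, rfl⟩

/-- Since `e * a * e = c • e`, a single vector near the range of `e` and almost killed by `a`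
already bounds `c`. -/
theorem mul_eq_zero_of_approx {a e : H →L[ℂ] H} (he : e ∈ M.minimalProjections) (haM : a ∈ M)
    (ha : 0 ≤ a) (ha1 : ‖a‖ ≤ 1)
    (h : ∀ ε > (0 : ℝ), ∃ ξ : H, ‖ξ‖ = 1 ∧ ‖ξ - e ξ‖ < ε ∧ ‖a ξ‖ < ε) : a * e = 0 := by
  refine mul_eq_zero_of_compression_eq_zero ha ha1 he.1.2.1 ?_
  obtain ⟨c, hc⟩ := exists_compression_eq_smul he haM
  have he1 : ‖e‖ ≤ 1 := (M.nonzeroProjections_subset he.1).2.2.le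
  suffices hc0 : ‖c‖ ≤ 0 by rw [hc, norm_le_zero_iff.1 hc0, zero_smul]
  refine le_of_forall_pos_le_add fun ε hε => ?_
  set δ := min (1 / 2) (ε / 4) with hδ
  have hδ1 : δ ≤ 1 / 2 := min_le_left _ _
  have hδ2 : δ ≤ ε / 4 := min_le_right _ _
  obtain ⟨ξ, h1, h2, h3⟩ := h δ (lt_min (by norm_num) (by positivity))
  have h4 : c • e ξ = e (a (e ξ)) := congr($hc.symm ξ)
  have h5 : ‖e (a (e ξ))‖ ≤ ‖a (e ξ)‖ := by simpa using e.le_of_opNorm_le he1 (a (e ξ))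
  have h6 : ‖a (ξ - e ξ)‖ ≤ ‖ξ - e ξ‖ := by simpa using a.le_of_opNorm_le ha1 (ξ - e ξ)
  have h7 : ‖a (e ξ)‖ ≤ ‖a ξ‖ + ‖a (ξ - e ξ)‖ := by
    have : a (e ξ) = a ξ - a (ξ - e ξ) := by simp
    rw [this]
    exact norm_sub_le _ _
  have h8 : 1 / 2 ≤ ‖e ξ‖ := by
    have := norm_sub_norm_le ξ (e ξ)
    linarith
  have h9 : ‖c‖ * ‖e ξ‖ ≤ 2 * δ := by
    rw [← norm_smul, h4]
    linarith
  nlinarith [norm_nonneg c]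

/-- Here `r * e` is a nonzero multiple of a partial isometry with initial projection `e`; the
rescaled `r * e * r` is its final projection, which inherits minimality. -/
theorem compression_mem_minimalProjections {e r : H →L[ℂ] H} (he : e ∈ M.minimalProjections)
    (hrM : r ∈ M) (hr : IsStarProjection r) (hre : r * e ≠ 0) :
    ∃ c : ℂ, c ≠ 0 ∧ e * r * e = c • e ∧ c⁻¹ • (r * e * r) ∈ M.minimalProjections := by
  obtain ⟨⟨heM, hep, he0⟩, -⟩ := id he
  obtain ⟨c, hc⟩ := exists_compression_eq_smul he hrM
  have hrs : star r = r := hr.isSelfAdjoint.star_eq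
  have hes : star e = e := hep.isSelfAdjoint.star_eq
  have hrr : r * r = r := hr.isIdempotentElem.eq
  have hee : e * e = e := hep.isIdempotentElem.eq
  have hc0 : c ≠ 0 := by
    rintro rfl
    apply hre
    rw [← CStarRing.star_mul_self_eq_zero_iff, star_mul, hrs, hes, mul_assoc, ← mul_assoc r,
      hrr, ← mul_assoc, hc, zero_smul]
  have hcs : star c = c := by
    have h1 : star c • e = c • e := by
      rw [← hc]
      conv_lhs => rw [← hes, ← star_smul, ← hc]
      simp only [star_mul, hrs, hes, mul_assoc]
    exact smul_left_injective ℂ he0 h1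
  have hprod : ∀ x : H →L[ℂ] H, r * e * r * x * (r * e * r) = r * (e * (r * x * r) * e) * r := by
    intro x
    simp only [mul_assoc]
  have hidem : r * e * r * (r * e * r) = c • (r * e * r) := by
    have h1 := hprod 1
    rw [mul_one, mul_one, hrr, hc] at h1
    rw [h1, mul_smul_comm, smul_mul_assoc]
  refine ⟨c, hc0, hc, ⟨smul_mem_of_mem (mul_mem (mul_mem hrM heM) hrM) _, ⟨?_, ?_⟩, ?_⟩, ?_⟩
  · rw [IsIdempotentElem, smul_mul_smul_comm, hidem, smul_smul]
    congr 1
    field_simp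
  · rw [IsSelfAdjoint, star_smul, star_inv₀, hcs]
    simp only [star_mul, hrs, hes, mul_assoc]
  · intro h0
    rcases smul_eq_zero.1 h0 with h1 | h1
    · exact hc0 (inv_eq_zero.1 h1)
    · have h2 : e * (r * e * r) * e = (c * c) • e := by
        have h3 : e * (r * e * r) * e = (e * r * e) * (e * r * e) := by
          have : e * r * e * (e * r * e) = e * r * (e * e) * r * e := by simp only [mul_assoc]
          rw [this, hee]
          simp only [mul_assoc]
        rw [h3, hc, smul_mul_smul_comm, hee]
      rw [h1, mul_zero, zero_mul] at h2
      rcases smul_eq_zero.1 h2.symm with h3 | h3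
      · exact hc0 (mul_self_eq_zero.1 h3)
      · exact he0 h3
  · ext y
    constructor
    · rintro ⟨x, hx, rfl⟩
      obtain ⟨d, hd⟩ := exists_compression_eq_smul he (mul_mem (mul_mem hrM hx) hrM)
      refine ⟨c⁻¹ * d, ?_⟩
      rw [smul_mul_assoc, smul_mul_smul_comm, hprod, hd, mul_smul_comm, smul_mul_assoc, smul_smul,
        smul_smul]
      congr 1
      ring
    · rintro ⟨d, rfl⟩
      refine ⟨d • 1, smul_mem_of_mem (one_mem M) d, ?_⟩
      have h1 : c⁻¹ • (r * e * r) * (c⁻¹ • (r * e * r)) = c⁻¹ • (r * e * r) := by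
        rw [smul_mul_smul_comm, hidem, smul_smul]
        congr 1
        field_simp
      rw [mul_smul_comm d, mul_one, smul_mul_assoc d, h1]

/-- Left multiplication by `a` kills the span of the minimal projections, hence by weak* continuity
its closure, which contains `1`. -/
theorem IsAtomicAlgebra.eq_zero_of_mul_minimal (hM : M.IsAtomicAlgebra) {a : H →L[ℂ] H}
    (h : ∀ e ∈ M.minimalProjections, a * e = 0) : a = 0 := by
  have h1 : (1 : H →L[ℂ] H) ∈ @closure _ (ultraweakTopology H)
      (Submodule.span ℂ M.minimalProjections : Set (H →L[ℂ] H)) := by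
    rw [hM]
    exact one_mem M
  have hspan : ∀ x ∈ Submodule.span ℂ M.minimalProjections, a * x = 0 := by
    intro x hx
    induction hx using Submodule.span_induction with
    | mem x hx => exact h x hx
    | zero => exact mul_zero a
    | add x y _ _ hx hy => rw [mul_add, hx, hy, add_zero]
    | smul c x _ hx => rw [mul_smul_comm, hx, smul_zero]
  ext ξ
  refine ext_inner_left ℂ fun η => ?_
  -- Sequences with one nonzero term realise the vector functional `x ↦ ⟪η, a (x ξ)⟫`, with `a`
  -- moved to the left as its adjoint.
  let ξ' : ℕ → H := Pi.single 0 ξ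
  let η' : ℕ → H := Pi.single 0 (star a η)
  have hfun : ∀ x : H →L[ℂ] H, ∑' n, inner ℂ (η' n) (x (ξ' n)) = inner ℂ η (a (x ξ)) := by
    intro x
    rw [tsum_eq_single 0]
    · simp only [η', ξ', Pi.single_eq_same, ContinuousLinearMap.star_eq_adjoint,
        ContinuousLinearMap.adjoint_inner_left]
    · intro n hn
      simp [ξ', hn]
  have hsum : ∀ ζ : H, Summable fun n => ‖(Pi.single 0 ζ : ℕ → H) n‖ ^ 2 := by
    intro ζ
    refine summable_of_ne_finset_zero (s := {0}) fun n hn => ?_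
    rw [Finset.mem_singleton] at hn
    simp [hn]
  have hcont : @Continuous _ _ (ultraweakTopology H) _
      fun x : H →L[ℂ] H => inner ℂ η (a (x ξ)) := by
    simp only [← hfun]
    refine continuous_iff_le_induced.2 ?_
    exact iInf_le_of_le ξ' (iInf_le_of_le η' (iInf_le_of_le (hsum ξ) (iInf_le _ (hsum _))))
  have hclosed : @IsClosed _ (ultraweakTopology H) {x : H →L[ℂ] H | inner ℂ η (a (x ξ)) = 0} :=
    @IsClosed.preimage _ _ (ultraweakTopology H) _ _ hcont _ (isClosed_singleton (x := (0 : ℂ)))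
  have := (@closure_minimal _ (ultraweakTopology H) _ _ (fun x hx => by
    have h2 : a (x ξ) = 0 := congr($(hspan x hx) ξ)
    simp [h2]) hclosed) h1
  simpa using this

/-- If `r * e ≠ 0` for a minimal `e`, then `r * e * r` is a multiple of a minimal projection below
`r`, and `a` kills it. -/
theorem IsAtomicAlgebra.mul_eq_zero (hM : M.IsAtomicAlgebra) {a r : H →L[ℂ] H} (hrM : r ∈ M)
    (hr : IsStarProjection r) (h : ∀ q ∈ M.minimalProjections, r * q = q → a * q = 0) :
    a * r = 0 := by
  refine hM.eq_zero_of_mul_minimal fun e he => ?_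
  by_contra hne
  have hre : r * e ≠ 0 := fun h0 => hne (by rw [mul_assoc, h0, mul_zero])
  obtain ⟨c, hc0, hc, hq⟩ := compression_mem_minimalProjections he hrM hr hre
  have hrr : r * r = r := hr.isIdempotentElem.eq
  have h1 := h _ hq (by rw [mul_smul_comm, ← mul_assoc, ← mul_assoc, hrr])
  rw [mul_smul_comm, smul_eq_zero_iff_right (inv_ne_zero hc0)] at h1
  have h2 : a * r * (e * r * e) = 0 := by
    have : a * r * (e * r * e) = a * (r * e * r) * e := by simp only [mul_assoc]
    rw [this, h1, zero_mul]
  rw [hc, mul_smul_comm, smul_eq_zero_iff_right hc0] at h2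
  exact hne h2

end Atomic

/-! ### Metric characterisation of projections. -/

section Sphere

variable {H : Type*} [NormedAddCommGroup H] [InnerProductSpace ℂ H] [CompleteSpace H]
  {M : VonNeumannAlgebra H}

theorem mul_self_mem_posUnitSphere {a : H →L[ℂ] H} (ha : a ∈ M.posUnitSphere) :
    a * a ∈ M.posUnitSphere := by
  have hs : star a = a := (IsSelfAdjoint.of_nonneg ha.2.1).star_eq
  refine ⟨mul_mem ha.1 ha.1, ?_, ?_⟩
  · conv => enter [2, 1]; rw [← hs]
    exact star_mul_self_nonneg a
  · conv_lhs => enter [1, 1]; rw [← hs]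
    rw [CStarRing.norm_star_mul_self, ha.2.2, one_mul]

theorem posUnitSphere.norm_sub_eq_one_iff {a b : H →L[ℂ] H} (ha : a ∈ M.posUnitSphere)
    (hb : b ∈ M.posUnitSphere) :
    ‖a - b‖ = 1 ↔ ApproxSeparated a b ∨ ApproxSeparated b a :=
  VonNeumannAlgebra.norm_sub_eq_one_iff ha.2.1 hb.2.1 ha.2.2.le hb.2.2.le

theorem isStarProjection_of_sphere {a : H →L[ℂ] H} (ha : a ∈ M.posUnitSphere)
    (h : ∀ b ∈ M.posUnitSphere, (∀ x ∈ M.posUnitSphere, ‖x - a‖ = 1 → ‖x - b‖ = 1) → b = a) :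
    IsStarProjection a := by
  refine ⟨h _ (mul_self_mem_posUnitSphere ha) fun x hx hxa => ?_, .of_nonneg ha.2.1⟩
  rw [posUnitSphere.norm_sub_eq_one_iff hx ha] at hxa
  rw [posUnitSphere.norm_sub_eq_one_iff hx (mul_self_mem_posUnitSphere ha)]
  exact hxa.imp (fun h => h.sq_right ha.2.2.le) (fun h => h.sq_left ha.2.2.le)

/-- The midpoint of a projection and a nonzero projection below it lies in the sphere. -/
theorem half_add_mem_posUnitSphere {r q : H →L[ℂ] H} (hrM : r ∈ M) (hr : IsStarProjection r)
    (hq : q ∈ M.nonzeroProjections) (hrq : r * q = q) :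
    (2⁻¹ : ℂ) • (r + q) ∈ M.posUnitSphere := by
  have hq1 : ‖q‖ = 1 := (M.nonzeroProjections_subset hq).2.2
  have hqq : q * q = q := hq.2.1.isIdempotentElem.eq
  have hr0 : r ≠ 0 := fun h0 => hq.2.2 (by rw [← hrq, h0, zero_mul])
  have hr1 : ‖r‖ = 1 := (M.nonzeroProjections_subset ⟨hrM, hr, hr0⟩).2.2
  refine ⟨smul_mem_of_mem (add_mem hrM hq.1) _, ?_, le_antisymm ?_ ?_⟩
  · have h1 : (2⁻¹ : ℂ) • (r + q) = (2⁻¹ : ℝ) • (r + q) := by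
      rw [RCLike.real_smul_eq_coe_smul (K := ℂ)]
      norm_num
    rw [h1]
    exact smul_nonneg (by norm_num) (add_nonneg hr.nonneg hq.2.1.nonneg)
  · rw [norm_smul]
    have := norm_add_le r q
    norm_num
    linarith
  · have h1 : (2⁻¹ : ℂ) • (r + q) * q = q := by
      rw [smul_mul_assoc, add_mul, hrq, hqq, ← two_smul ℂ, smul_smul]
      norm_num
    have h2 := norm_mul_le ((2⁻¹ : ℂ) • (r + q)) q
    rwa [h1, hq1, mul_one] at h2

theorem exists_unit_fixed {e : H →L[ℂ] H} (he : e ∈ M.nonzeroProjections) :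
    ∃ ξ : H, ‖ξ‖ = 1 ∧ e ξ = ξ := by
  obtain ⟨η, hη⟩ : ∃ η, e η ≠ 0 := by
    by_contra! h0
    exact he.2.2 (ContinuousLinearMap.ext h0)
  refine ⟨((‖e η‖⁻¹ : ℝ) : ℂ) • e η, ?_, ?_⟩
  · have : ‖e η‖ ≠ 0 := norm_ne_zero_iff.2 hη
    simp [norm_smul, this]
  · rw [map_smul]
    congr 1
    exact congr($(he.2.1.isIdempotentElem.eq) η)

theorem mul_eq_zero_of_minimal_orthogonal {p b e : H →L[ℂ] H} (hp : p ∈ M.nonzeroProjections)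
    (hb : b ∈ M.posUnitSphere)
    (h : ∀ x ∈ M.posUnitSphere, ‖x - p‖ = 1 → ‖x - b‖ = 1)
    (he : e ∈ M.minimalProjections) (hpe : p * e = 0) : b * e = 0 := by
  have hee : e * e = e := he.1.2.1.isIdempotentElem.eq
  have he1 : ‖e‖ = 1 := (M.nonzeroProjections_subset he.1).2.2
  obtain ⟨ξ, hξ, heξ⟩ := exists_unit_fixed he.1
  have : Nontrivial H := ⟨ξ, 0, by rintro rfl; simp at hξ⟩
  -- The test point `(1 + e) / 2` almost fixes only vectors near the range of `e`, and it is
  -- invertible with inverse `2 - e`, so it cannot almost kill a unit vector.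
  have hx := half_add_mem_posUnitSphere (one_mem M) (.one _) he.1 (one_mul e)
  have hxp : ‖(2⁻¹ : ℂ) • (1 + e) - p‖ = 1 := by
    rw [posUnitSphere.norm_sub_eq_one_iff hx (M.nonzeroProjections_subset hp)]
    refine .inl (approxSeparated_of_fixed hξ ?_ ?_)
    · simp only [smul_apply, add_apply, one_apply_eq_self, heξ]
      module
    · rw [← heξ]
      exact congr($hpe ξ)
  have hxb := (posUnitSphere.norm_sub_eq_one_iff hx hb).1 (h _ hx hxp)
  rcases hxb with hs | hs
  · refine mul_eq_zero_of_approx he hb.1 hb.2.1 hb.2.2.le fun ε hε => ?_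
    obtain ⟨ζ, h1, h2, h3⟩ := hs (ε / 2) (half_pos hε)
    refine ⟨ζ, h1, ?_, h3.trans (half_lt_self hε)⟩
    have h4 : ζ - e ζ = -((2 : ℂ) • (((2⁻¹ : ℂ) • (1 + e)) ζ - ζ)) := by
      simp only [smul_apply, add_apply,
        one_apply_eq_self]
      module
    rw [h4, norm_neg, norm_smul]
    norm_num at h2 ⊢
    linarith
  · exfalso
    obtain ⟨ζ, h1, -, h3⟩ := hs (1 / 3) (by norm_num)
    have h4 : ‖ζ‖ < 1 := by
      refine norm_apply_lt_of_eq_mul (a := 1) (c := (2 : ℂ) • 1 - e)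
        (b := (2⁻¹ : ℂ) • (1 + e)) (C := 3) ?_ ?_ (by norm_num) (ξ := ζ) ?_
      · rw [mul_smul_comm, sub_mul, smul_mul_assoc, one_mul, mul_add, mul_one, hee]
        module
      · refine (norm_sub_le _ _).trans ?_
        rw [norm_smul, he1, norm_one]
        norm_num
      · exact h3
    linarith

theorem one_sub_mul_eq_zero_of_minimal_le (hM : M.IsAtomicAlgebra) {p b e : H →L[ℂ] H}
    (hp : p ∈ M.nonzeroProjections) (hb : b ∈ M.posUnitSphere)
    (h : ∀ x ∈ M.posUnitSphere, ‖x - p‖ = 1 → ‖x - b‖ = 1)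
    (he : e ∈ M.minimalProjections) (hpe : p * e = e) : (1 - b) * e = 0 := by
  have hee : e * e = e := he.1.2.1.isIdempotentElem.eq
  have he1 : ‖e‖ = 1 := (M.nonzeroProjections_subset he.1).2.2
  have hb1 : b ≤ 1 := (CStarAlgebra.norm_le_one_iff_of_nonneg b hb.2.1).1 hb.2.2.le
  have hcM : 1 - b ∈ M := sub_mem (one_mem M) hb.1
  have hc0 : 0 ≤ 1 - b := sub_nonneg.2 hb1
  have hc1 : ‖1 - b‖ ≤ 1 :=
    (CStarAlgebra.norm_le_one_iff_of_nonneg _ hc0).2 (sub_le_self _ hb.2.1)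
  have hfM : 1 - e ∈ M := sub_mem (one_mem M) he.1.1
  have hf : IsStarProjection (1 - e) := he.1.2.1.one_sub
  have hone : ‖(1 : H →L[ℂ] H)‖ ≤ 1 := ContinuousLinearMap.norm_id_le
  have hfix : ∀ ξ, ‖(1 - b) ξ‖ = ‖b ξ - ξ‖ := fun ξ => by
    rw [sub_apply, one_apply_eq_self, norm_sub_rev]
  -- If `b` kills every minimal projection below `1 - e`, then `b = e * b`, and vectors almost fixed
  -- by `b` lie near the range of `e`. Otherwise the test point is `(1 - e + q) / 2` with `b * q ≠
  -- 0`.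
  by_cases hq : ∀ q ∈ M.minimalProjections, (1 - e) * q = q → b * q = 0
  · have h0 : b * (1 - e) = 0 := hM.mul_eq_zero hfM hf hq
    have hbe : e * b = b := by
      have h1 := congr(star $h0)
      rw [star_mul, hf.isSelfAdjoint.star_eq, (IsSelfAdjoint.of_nonneg hb.2.1).star_eq, star_zero,
        sub_mul, one_mul, sub_eq_zero] at h1
      exact h1.symm
    have hs : ApproxSeparated b 0 := by
      have h1 : ‖b - 0‖ = 1 := by rw [sub_zero, hb.2.2]
      refine ((norm_sub_eq_one_iff hb.2.1 le_rfl hb.2.2.le (by simp)).1 h1).resolve_right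
        fun h2 => ?_
      obtain ⟨ξ, h3, h4, -⟩ := h2 1 one_pos
      simp [h3] at h4
    refine mul_eq_zero_of_approx he hcM hc0 hc1 fun ε hε => ?_
    obtain ⟨ξ, h1, h2, -⟩ := hs (ε / 2) (half_pos hε)
    refine ⟨ξ, h1, ?_, by rw [hfix]; linarith⟩
    refine norm_apply_lt_of_eq_mul (a := 1 - e) (b := 1 - b) (c := 1 - e) (C := 2) ?_ ?_
      (by norm_num) ?_
    · rw [mul_sub, sub_mul _ _ b, hbe, mul_one, one_mul, sub_self, sub_zero]
    · refine (norm_sub_le _ _).trans ?_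
      rw [he1]
      linarith
    · rwa [hfix]
  · push Not at hq
    obtain ⟨q, hq, hfq, hbq⟩ := hq
    have hqq : q * q = q := hq.1.2.1.isIdempotentElem.eq
    have hq1 : ‖q‖ = 1 := (M.nonzeroProjections_subset hq.1).2.2
    have heq : e * q = 0 := by
      rw [sub_mul, one_mul, sub_eq_self] at hfq
      exact hfq
    have hqe : q * e = 0 := by
      have h1 := congr(star $heq)
      rwa [star_mul, hq.1.2.1.isSelfAdjoint.star_eq, he.1.2.1.isSelfAdjoint.star_eq,
        star_zero] at h1
    have hx := half_add_mem_posUnitSphere hfM hf hq.1 hfq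
    have hxp : ‖(2⁻¹ : ℂ) • (1 - e + q) - p‖ = 1 := by
      obtain ⟨ξ, hξ, heξ⟩ := exists_unit_fixed he.1
      rw [posUnitSphere.norm_sub_eq_one_iff hx (M.nonzeroProjections_subset hp)]
      refine .inr (approxSeparated_of_fixed hξ ?_ ?_)
      · rw [← heξ]
        exact congr($hpe ξ)
      · have h1 : q ξ = 0 := by
          rw [← heξ]
          exact congr($hqe ξ)
        simp only [smul_apply, add_apply, sub_apply, one_apply_eq_self, heξ, h1]
        simp
    have hbound : ∀ {r : H →L[ℂ] H}, ‖r‖ = 1 → ‖(2 : ℂ) • 1 - r‖ ≤ 3 := fun {r} hr => by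
      refine (norm_sub_le _ _).trans ?_
      rw [norm_smul, hr]
      norm_num
      linarith
    -- Vectors almost fixed by the test point lie near the range of `q`; if `b` almost kills them,
    -- then `b * q = 0`. Hence `b` almost fixes vectors almost killed by the test point, and these
    -- lie near the range of `e`.
    rcases (posUnitSphere.norm_sub_eq_one_iff hx hb).1 (h _ hx hxp) with hs | hs
    · refine absurd (mul_eq_zero_of_approx hq hb.1 hb.2.1 hb.2.2.le fun ε hε => ?_) hbq
      obtain ⟨ζ, h1, h2, h3⟩ := hs (ε / 3) (by positivity)
      refine ⟨ζ, h1, ?_, by linarith⟩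
      refine norm_apply_lt_of_eq_mul (a := 1 - q) (c := (2 : ℂ) • 1 - e)
        (b := 1 - (2⁻¹ : ℂ) • (1 - e + q)) (C := 3) ?_ (hbound he1) (by norm_num) ?_
      · simp only [mul_sub, sub_mul, mul_add, smul_mul_assoc, mul_smul_comm, one_mul, mul_one,
          hee, heq]
        module
      · rwa [sub_apply, one_apply_eq_self, norm_sub_rev]
    · refine mul_eq_zero_of_approx he hcM hc0 hc1 fun ε hε => ?_
      obtain ⟨ζ, h1, h2, h3⟩ := hs (ε / 3) (by positivity)
      refine ⟨ζ, h1, ?_, by rw [hfix]; linarith⟩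
      refine norm_apply_lt_of_eq_mul (a := 1 - e) (c := (2 : ℂ) • 1 - q)
        (b := (2⁻¹ : ℂ) • (1 - e + q)) (C := 3) ?_ (hbound hq1) (by norm_num) h3
      simp only [mul_sub, sub_mul, mul_add, smul_mul_assoc, mul_smul_comm, one_mul, mul_one,
        hqq, hqe]
      module

/-- In an atomic von Neumann algebra the projections are the points of the positive unit sphere
which are determined by the points at distance one from them. -/
theorem IsAtomicAlgebra.isStarProjection_iff (hM : M.IsAtomicAlgebra) {a : H →L[ℂ] H}
    (ha : a ∈ M.posUnitSphere) :
    IsStarProjection a ↔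
      ∀ b ∈ M.posUnitSphere, (∀ x ∈ M.posUnitSphere, ‖x - a‖ = 1 → ‖x - b‖ = 1) → b = a := by
  refine ⟨fun hp b hb h => ?_, isStarProjection_of_sphere ha⟩
  have ha' : a ∈ M.nonzeroProjections := ⟨ha.1, hp, by rintro rfl; simpa using ha.2.2⟩
  have h1 : (1 - b) * a = 0 := hM.mul_eq_zero ha.1 hp fun q hq haq =>
    one_sub_mul_eq_zero_of_minimal_le hM ha' hb h hq haq
  have h2 : b * (1 - a) = 0 := hM.mul_eq_zero (sub_mem (one_mem M) ha.1) hp.one_sub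
    fun q hq haq => mul_eq_zero_of_minimal_orthogonal ha' hb h hq (by
      rwa [sub_mul, one_mul, sub_eq_self] at haq)
  rw [sub_mul, one_mul, sub_eq_zero] at h1
  rw [mul_sub, mul_one, sub_eq_zero] at h2
  rw [h2, ← h1]

theorem mem_range_projInclusion {a : M.posUnitSphere} :
    a ∈ Set.range M.projInclusion ↔ IsStarProjection (a : H →L[ℂ] H) := by
  constructor
  · rintro ⟨p, rfl⟩
    exact p.2.2.1
  · intro h
    refine ⟨⟨a, a.2.1, h, fun h0 => ?_⟩, rfl⟩
    have := a.2.2.2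
    rw [h0, norm_zero] at this
    exact zero_ne_one this

theorem IsAtomicAlgebra.mem_range_projInclusion_iff (hM : M.IsAtomicAlgebra)
    (a : M.posUnitSphere) :
    a ∈ Set.range M.projInclusion ↔
      ∀ b : M.posUnitSphere, (∀ x : M.posUnitSphere, dist x a = 1 → dist x b = 1) → b = a := by
  rw [mem_range_projInclusion, hM.isStarProjection_iff a.2]
  simp only [Subtype.forall, Subtype.dist_eq, dist_eq_norm, Subtype.ext_iff]

end Sphere

end VonNeumannAlgebra

theorem mainTheorem6
    {H : Type*} [NormedAddCommGroup H] [InnerProductSpace ℂ H] [CompleteSpace H]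
    {K : Type*} [NormedAddCommGroup K] [InnerProductSpace ℂ K] [CompleteSpace K]
    (M : VonNeumannAlgebra H) (N : VonNeumannAlgebra K)
    (hM : M.IsAtomicAlgebra) (hN : N.IsAtomicAlgebra)
    (Δ : M.posUnitSphere → N.posUnitSphere)
    (hΔ : Isometry Δ) (hsurj : Function.Surjective Δ) :
    Δ '' Set.range M.projInclusion = Set.range N.projInclusion ∧
    ∃ Φ : M.nonzeroProjections → N.nonzeroProjections,
      (∀ p, N.projInclusion (Φ p) = Δ (M.projInclusion p)) ∧
      Isometry Φ ∧ Function.Surjective Φ := by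
  -- Surjectivity of `Δ` lets both quantifiers over `S(N⁺)` in the metric criterion be pulled back
  -- to `S(M⁺)`.
  have hiff : ∀ a, Δ a ∈ Set.range N.projInclusion ↔ a ∈ Set.range M.projInclusion := fun a => by
    rw [hM.mem_range_projInclusion_iff, hN.mem_range_projInclusion_iff]
    simp only [hsurj.forall, hΔ.dist_eq, hΔ.injective.eq_iff]
  choose Φ hΦ using fun p => (hiff (M.projInclusion p)).2 ⟨p, rfl⟩
  have hsurjΦ : Function.Surjective Φ := fun q => by
    obtain ⟨a, ha⟩ := hsurj (N.projInclusion q)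
    obtain ⟨p, rfl⟩ := (hiff a).1 (ha ▸ ⟨q, rfl⟩)
    exact ⟨p, Set.inclusion_injective N.nonzeroProjections_subset ((hΦ p).trans ha)⟩
  refine ⟨?_, Φ, hΦ, Isometry.of_dist_eq fun p q => ?_, hsurjΦ⟩
  · ext b
    obtain ⟨a, rfl⟩ := hsurj b
    rw [hΔ.injective.mem_set_image, hiff]
  · calc dist (Φ p) (Φ q) = dist (N.projInclusion (Φ p)) (N.projInclusion (Φ q)) := rfl
      _ = dist (M.projInclusion p) (M.projInclusion q) := by rw [hΦ, hΦ, hΔ.dist_eq]
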